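/- Let $\mathbb{F}_q$ be the finite field with $q$ elements, let $m\ge 1$ be an integer, and let $0\le u\le m(q-1)$. Let $\mathrm{RM}_q(u,m)\subseteq \mathbb{F}_q^{q^m}$ be the Reed–Muller code of order $u$ in $m$ variables, i.e. the set of all vectors $(f(P))_{P\in\mathbb{F}_q^m}$ where $f\in\mathbb{F}_q[X_1,\dots,X_m]$ has total degree at most $u$. A minimum weight codeword is a nonzero codeword whose Hamming weight (number of nonzero coordinates) is least among all nonzero codewords; let $\mathrm{N}_q(u,m)$ be the set of minimum weight codewords of $\mathrm{RM}_q(u,m)$. For integers $0\le k\le n$ let $\binom{n}{k}_q$ denote the number of $k$-dimensional linear subspaces of $\mathbb{F}_q^n$. Then there are unique integers $t,s$ with $0\le t\le m$, $0\le s<q-1$ and $u=t(q-1)+s$, and $$ |\mathrm{N}_q(u,m)|=\begin{cases}(q-1)\,q^t\,\dbinom{m}{t}_q & \text{if } s=0,\\[1em] (q-1)\,q^t\,\dbinom{m}{t}_q\dbinom{m-t}{1}_q\dbinom{q}{s} & \text{if } s\ne 0.\end{cases} $$ -/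

import Mathlib

/-- The Reed–Muller code of order `u` in `m` variables over the finite field `F`: all evaluation
vectors, indexed by the points of `F ^ m`, of polynomials of total degree at most `u`. -/
noncomputable def reedMuller (F : Type*) [Field F] (u m : ℕ) : Submodule F ((Fin m → F) → F) :=
  (MvPolynomial.restrictTotalDegree (Fin m) F u).map (MvPolynomial.evalₗ F (Fin m))

/-- The minimum weight codewords of a linear code `C`: the nonzero codewords whose Hamming weight
is least among those of all nonzero codewords. -/
def minWeightCodewords {F ι : Type*} [Field F] [DecidableEq F] [Fintype ι]
    (C : Submodule F (ι → F)) : Set (ι → F) :=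
  {c | c ∈ C ∧ c ≠ 0 ∧ ∀ c' ∈ C, c' ≠ 0 → hammingNorm c ≤ hammingNorm c'}

/-- The `q`-binomial coefficient, `q = |F|`: the number of `k`-dimensional linear subspaces
of `F ^ n`. -/
noncomputable def qBinomial (F : Type*) [Field F] (n k : ℕ) : ℕ :=
  Nat.card {W : Submodule F (Fin n → F) // Module.finrank F W = k}

/-! Write `q = |F|`. Functions of degree at most `u` are treated without coordinates, as `polyFun`,
and matched with the code in `reedMuller_eq_polyFun`; induction can then pass freely to hyperplanes
and flats.

Let `f ≠ 0` have degree at most `u` on a space of dimension `m + 1`, and let `l` be a nonzero linear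
form. If `f` vanishes on exactly `k` of the `q` hyperplanes `l = a`, then `f` is divisible by the
`k` factors `l - b`, so its restriction to each other hyperplane has degree at most `u - k`. By
induction the weight is at least `(q - k) * minDist q m (u - k)`, which is at least `minDist q (m +
1) u` (`minDist_le_weight`). For `u = t(q-1) + s`, equality forces `k` to be `0`, `s` or `q - 1`
(`eq_of_minDist_eq_mul`).

Let `f` attain the bound, with `t > 0`. Apart from the case of a one-point support, a double count
gives a form with `k ≠ 0`. If `k = q - 1`, the support lies in a hyperplane. If `k = s`, then by
induction some slice is nonzero on a whole flat, and a hyperplane through that flat and one more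
support point carries so many points that it must contain the whole support
(`exists_hyperplane_of_minDist`). Iterating, the support lies in a flat of codimension `t` on which
`f` has degree `s` (`exists_flat_of_minDist`).

There are `q ^ t * qBinomial F m t` such flats, and each is determined by `f`. On a flat the minimum
weight functions are the `q - 1` nonzero constants if `s = 0`, and otherwise the products `c * ∏ b ∈
B, (l - b)` with `B.card = s`, counted by the line spanned by `l`, the scalar `c` and the set `B`.
-/

/-! ### Arithmetic of the minimum distance -/

/-- The smallest weight of a nonzero function of degree at most `u` on a space of dimension `m`
over a field with `q` elements. -/
def minDist (q : ℕ) : ℕ → ℕ → ℕ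
  | 0, _ => 1
  | m + 1, u => if u < q - 1 then (q - u) * q ^ m else minDist q m (u - (q - 1))

theorem minDist_of_lt {q m u : ℕ} (hu : u < q - 1) : minDist q (m + 1) u = (q - u) * q ^ m := by
  rw [minDist, if_pos hu]

theorem minDist_of_not_lt {q m u : ℕ} (hu : ¬u < q - 1) :
    minDist q (m + 1) u = minDist q m (u - (q - 1)) := by
  rw [minDist, if_neg hu]

/-- This is the numerical half of the slicing induction, with `k` the number of vanishing slices. In
the two boundary cases the right side exceeds the left by `j * k` or `c * j` times a power of `q`;
otherwise both sides reduce to one dimension less. -/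
theorem minDist_le_mul {q : ℕ} (m : ℕ) : ∀ {u k : ℕ}, k < q → k ≤ u →
    minDist q (m + 1) u ≤ (q - k) * minDist q m (u - k) := by
  induction m with
  | zero =>
    intro u k hk hku
    simp only [minDist]
    split_ifs <;> simp <;> omega
  | succ m ih =>
    intro u k hk hku
    by_cases hu : u < q - 1
    · have h1 : u - k < q - 1 := by omega
      simp only [minDist, if_pos hu, if_pos h1]
      obtain ⟨j, rfl⟩ := Nat.exists_eq_add_of_le hku
      obtain ⟨c, rfl⟩ := Nat.exists_eq_add_of_le (show k + j ≤ q by omega)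
      have e1 : k + j + c - (k + j) = c := by omega
      have e2 : k + j + c - k = j + c := by omega
      have e3 : k + j - k = j := by omega
      have e4 : k + j + c - j = k + c := by omega
      rw [e1, e2, e3, e4, pow_succ]
      have : c * (k + j + c) ≤ (j + c) * (k + c) := by nlinarith [Nat.zero_le (j * k)]
      calc _ = (c * (k + j + c)) * (k + j + c) ^ m := by ring
        _ ≤ ((j + c) * (k + c)) * (k + j + c) ^ m := Nat.mul_le_mul_right _ this
        _ = _ := by ring
    · rw [minDist_of_not_lt hu]
      by_cases h1 : u - k < q - 1
      · have h2 : u - (q - 1) < q - 1 := by omega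
        simp only [minDist, if_pos h1, if_pos h2]
        -- Substituting `u = (q - 1) + v`, `k = v + j`, `q = v + j + 1 + c` removes all truncated
        -- subtractions.
        obtain ⟨v, rfl⟩ := Nat.exists_eq_add_of_le (show q - 1 ≤ u by omega)
        obtain ⟨j, rfl⟩ := Nat.exists_eq_add_of_le (show v ≤ k by omega)
        obtain ⟨c, rfl⟩ := Nat.exists_eq_add_of_le (show v + j + 1 ≤ q by omega)
        have e1 : v + j + 1 + c - (v + j + 1 + c - 1 + v - (v + j + 1 + c - 1)) = j + 1 + c := by
          omega
        have e2 : v + j + 1 + c - (v + j) = c + 1 := by omega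
        have e3 : v + j + 1 + c - (v + j + 1 + c - 1 + v - (v + j)) = j + 1 := by omega
        rw [e1, e2, e3, ← mul_assoc]
        exact Nat.mul_le_mul_right _ (by nlinarith [Nat.zero_le (c * j)])
      · rw [minDist_of_not_lt h1]
        have := @ih (u - (q - 1)) k hk (by omega)
        rwa [show u - (q - 1) - k = u - k - (q - 1) by omega] at this

/-- The excess `j * k` or `c * j` found in `minDist_le_mul` must vanish, and each factor being zero
is one of the listed values of `k`. -/
theorem eq_of_minDist_eq_mul {q : ℕ} (m : ℕ) : ∀ {u k : ℕ}, k < q → k ≤ u →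
    u < (m + 1) * (q - 1) → minDist q (m + 1) u = (q - k) * minDist q m (u - k) →
    k = 0 ∨ k = u % (q - 1) ∨ k = q - 1 := by
  induction m with
  | zero =>
    intro u k hk hku hu h
    have hu : u < q - 1 := by simpa using hu
    simp only [minDist, if_pos hu, Nat.mod_eq_of_lt hu] at h ⊢
    simp at h
    omega
  | succ m ih =>
    intro u k hk hku hlt h
    have hq : 0 < q := by omega
    by_cases hu : u < q - 1
    · have h1 : u - k < q - 1 := by omega
      simp only [minDist, if_pos hu, if_pos h1, Nat.mod_eq_of_lt hu] at h ⊢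
      obtain ⟨j, rfl⟩ := Nat.exists_eq_add_of_le hku
      obtain ⟨c, rfl⟩ := Nat.exists_eq_add_of_le (show k + j ≤ q by omega)
      have e1 : k + j + c - (k + j) = c := by omega
      have e2 : k + j + c - k = j + c := by omega
      have e3 : k + j - k = j := by omega
      have e4 : k + j + c - j = k + c := by omega
      rw [e1, e2, e3, e4, pow_succ] at h
      have h' : (c * (k + j + c)) * (k + j + c) ^ m = ((j + c) * (k + c)) * (k + j + c) ^ m := by
        linarith
      have h'' := Nat.eq_of_mul_eq_mul_right (pow_pos hq m) h'
      have : j * k = 0 := by nlinarith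
      rcases Nat.mul_eq_zero.1 this with rfl | rfl
      · right; left; rfl
      · left; rfl
    · rw [minDist_of_not_lt hu] at h
      by_cases h1 : u - k < q - 1
      · have h2 : u - (q - 1) < q - 1 := by omega
        simp only [minDist, if_pos h1, if_pos h2] at h
        have hmod : u % (q - 1) = u - (q - 1) := by
          rw [Nat.mod_eq_sub_mod (by omega), Nat.mod_eq_of_lt h2]
        obtain ⟨v, rfl⟩ := Nat.exists_eq_add_of_le (show q - 1 ≤ u by omega)
        obtain ⟨j, rfl⟩ := Nat.exists_eq_add_of_le (show v ≤ k by omega)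
        obtain ⟨c, rfl⟩ := Nat.exists_eq_add_of_le (show v + j + 1 ≤ q by omega)
        have e1 : v + j + 1 + c - (v + j + 1 + c - 1 + v - (v + j + 1 + c - 1)) = j + 1 + c := by
          omega
        have e2 : v + j + 1 + c - (v + j) = c + 1 := by omega
        have e3 : v + j + 1 + c - (v + j + 1 + c - 1 + v - (v + j)) = j + 1 := by omega
        rw [e1, e2, e3, ← mul_assoc] at h
        have h'' := Nat.eq_of_mul_eq_mul_right (pow_pos hq m) h
        have : c * j = 0 := by nlinarith
        rcases Nat.mul_eq_zero.1 this with rfl | rfl <;> omega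
      · rw [minDist_of_not_lt h1] at h
        have hm : u % (q - 1) = (u - (q - 1)) % (q - 1) := Nat.mod_eq_sub_mod (by omega)
        rw [hm]
        refine ih hk (by omega) ?_ ?_
        · have : (m + 1 + 1) * (q - 1) = (m + 1) * (q - 1) + (q - 1) := by ring
          omega
        · rwa [show u - (q - 1) - k = u - k - (q - 1) by omega]

theorem minDist_le_pow {q : ℕ} (hq : 0 < q) (m : ℕ) : ∀ u, minDist q m u ≤ q ^ m := by
  induction m with
  | zero => simp [minDist]
  | succ m ih =>
    intro u
    rw [minDist, pow_succ']
    split_ifs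
    · exact Nat.mul_le_mul_right _ (by omega)
    · exact (ih _).trans (Nat.le_mul_of_pos_left _ hq)

theorem minDist_lt_pow {q : ℕ} (hq : 1 < q) (m : ℕ) {u : ℕ} (hu : 0 < u) :
    minDist q (m + 1) u < q ^ (m + 1) := by
  have hp : 0 < q ^ m := pow_pos (by omega) m
  rw [minDist, pow_succ']
  split_ifs
  · exact Nat.mul_lt_mul_of_pos_right (by omega) hp
  · have := minDist_le_pow (show 0 < q by omega) m (u - (q - 1))
    nlinarith

theorem minDist_add {q : ℕ} {t m s : ℕ} (htm : t ≤ m) :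
    minDist q m (t * (q - 1) + s) = minDist q (m - t) s := by
  induction t generalizing m with
  | zero => simp
  | succ t ih =>
    obtain ⟨m, rfl⟩ := Nat.exists_eq_add_of_le' (show 1 ≤ m by omega)
    have e : (t + 1) * (q - 1) + s = t * (q - 1) + s + (q - 1) := by ring
    rw [minDist, if_neg (by omega), e, Nat.add_sub_cancel, ih (by omega)]
    congr 1
    omega

/-- A minimum weight function of degree `s < q - 1` has too many nonzeros for its support to fit in
a proper subflat; this is what makes the flat unique. -/
theorem pow_lt_mul_minDist {q s : ℕ} (hs : s < q - 1) (r : ℕ) :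
    q ^ r < q * minDist q r s := by
  have hq : 0 < q := by omega
  cases r with
  | zero => simp [minDist]; omega
  | succ r =>
    rw [minDist_of_lt hs, pow_succ']
    have : 0 < q ^ r := pow_pos hq r
    exact Nat.mul_lt_mul_of_pos_left (by nlinarith [show 2 ≤ q - s by omega]) hq

/-! ### Polynomial functions without coordinates, and division by `l - b` -/

section PolyFun

variable (F V : Type*) [Field F] [AddCommGroup V] [Module F V]

/-- The space of affine functions `V → F`. -/
def affineFunctions : Submodule F (V → F) where
  carrier := {f | ∃ α : V →ᵃ[F] F, ⇑α = f}
  add_mem' := by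
    rintro _ _ ⟨α, rfl⟩ ⟨β, rfl⟩
    exact ⟨α + β, AffineMap.coe_add α β⟩
  zero_mem' := ⟨0, AffineMap.coe_zero⟩
  smul_mem' := by
    rintro c _ ⟨α, rfl⟩
    exact ⟨c • α, AffineMap.coe_smul c α⟩

/-- The functions `V → F` that are given by polynomials of degree at most `u`: the linear
combinations of products of `u` affine functions. -/
def polyFun (u : ℕ) : Submodule F (V → F) := affineFunctions F V ^ u

variable {F V}

theorem affine_mem_affineFunctions (α : V →ᵃ[F] F) : ⇑α ∈ affineFunctions F V := ⟨α, rfl⟩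

theorem dual_sub_mem_affineFunctions (l : Module.Dual F V) (b : F) :
    (fun x => l x - b) ∈ affineFunctions F V :=
  ⟨l.toAffineMap - AffineMap.const F V b, by ext; simp⟩

theorem const_mem_affineFunctions (c : F) : (fun _ => c) ∈ affineFunctions F V :=
  ⟨AffineMap.const F V c, by ext; simp⟩

theorem one_le_affineFunctions : (1 : Submodule F (V → F)) ≤ affineFunctions F V := by
  intro f hf
  obtain ⟨c, rfl⟩ := Submodule.mem_one.1 hf
  exact const_mem_affineFunctions c

theorem polyFun_mono {u v : ℕ} (h : u ≤ v) : polyFun F V u ≤ polyFun F V v :=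
  pow_le_pow_right' one_le_affineFunctions h

theorem mem_polyFun_zero {f : V → F} : f ∈ polyFun F V 0 ↔ ∃ c, f = fun _ => c := by
  rw [polyFun, pow_zero, Submodule.mem_one]
  exact ⟨fun ⟨c, h⟩ => ⟨c, h.symm⟩, fun ⟨c, h⟩ => ⟨c, h.symm⟩⟩

theorem const_mem_polyFun (c : F) (u : ℕ) : (fun _ => c) ∈ polyFun F V u :=
  polyFun_mono (Nat.zero_le u) (mem_polyFun_zero.2 ⟨c, rfl⟩)

theorem mul_mem_polyFun {u v : ℕ} {f g : V → F} (hf : f ∈ polyFun F V u)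
    (hg : g ∈ polyFun F V v) : f * g ∈ polyFun F V (u + v) := by
  rw [polyFun, pow_add]
  exact Submodule.mul_mem_mul hf hg

theorem pow_mem_polyFun {u : ℕ} {f : V → F} (hf : f ∈ polyFun F V u) (n : ℕ) :
    f ^ n ∈ polyFun F V (n * u) := by
  rw [polyFun, mul_comm, pow_mul]
  exact Submodule.pow_mem_pow _ hf n

theorem prod_mem_polyFun {ι : Type*} (s : Finset ι) {u : ℕ} {f : ι → V → F}
    (hf : ∀ i ∈ s, f i ∈ polyFun F V u) : ∏ i ∈ s, f i ∈ polyFun F V (s.card * u) := by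
  classical
  induction s using Finset.induction_on with
  | empty =>
    rw [Finset.prod_empty]
    exact const_mem_polyFun 1 _
  | insert i s hi ih =>
    rw [Finset.prod_insert hi, Finset.card_insert_of_notMem hi, add_mul, add_comm, one_mul]
    exact mul_mem_polyFun (hf i (Finset.mem_insert_self i s))
      (ih fun j hj => hf j (Finset.mem_insert_of_mem hj))

theorem dual_sub_mem_polyFun (l : Module.Dual F V) (b : F) :
    (fun x => l x - b) ∈ polyFun F V 1 := by
  rw [polyFun, pow_one]
  exact dual_sub_mem_affineFunctions l b

theorem comp_affine_mem_polyFun {W : Type*} [AddCommGroup W] [Module F W] (φ : W →ᵃ[F] V)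
    {u : ℕ} {f : V → F} (hf : f ∈ polyFun F V u) : f ∘ φ ∈ polyFun F W u := by
  induction hf using Submodule.pow_induction_on_left' with
  | algebraMap r => exact const_mem_polyFun r 0
  | add f g i _ _ hf hg => exact add_mem hf hg
  | mem_mul α hα i f _ hf =>
    obtain ⟨α, rfl⟩ := hα
    rw [polyFun, Nat.succ_eq_add_one, pow_succ']
    exact Submodule.mul_mem_mul (affine_mem_affineFunctions (α.comp φ)) hf

/-- The affine projection onto the hyperplane `l = b` along `v`, where `l v = 1`. -/
def hyperplaneProj (l : Module.Dual F V) (v : V) (b : F) : V →ᵃ[F] V :=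
  AffineMap.id F V - (LinearMap.toSpanSingleton F V v ∘ₗ l).toAffineMap + AffineMap.const F V (b • v)

theorem hyperplaneProj_apply (l : Module.Dual F V) (v : V) (b : F) (x : V) :
    hyperplaneProj l v b x = x - (l x - b) • v := by
  simp [hyperplaneProj, sub_smul]
  abel

/-- Division with remainder by `l - b`, the remainder being `f` read off on the hyperplane.
Induction on products of affine functions works by a Leibniz rule. The last clause is needed because
`u - 1` is truncated at `u = 0`. -/
theorem exists_eq_comp_hyperplaneProj_add (l : Module.Dual F V) (v : V) (b : F) {u : ℕ}
    {f : V → F} (hf : f ∈ polyFun F V u) :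
    ∃ g ∈ polyFun F V (u - 1),
      f = f ∘ hyperplaneProj l v b + (fun x => l x - b) * g ∧ (u = 0 → g = 0) := by
  induction hf using Submodule.pow_induction_on_left' with
  | algebraMap r => exact ⟨0, zero_mem _, by ext; simp, fun _ => rfl⟩
  | add f g i _ _ hf hg =>
    obtain ⟨f', hf', hf, hf0⟩ := hf
    obtain ⟨g', hg', hg, hg0⟩ := hg
    refine ⟨f' + g', add_mem hf' hg', ?_, fun h => by rw [hf0 h, hg0 h, add_zero]⟩
    funext x
    have h1 := congrFun hf x
    have h2 := congrFun hg x
    simp only [Pi.add_apply, Pi.mul_apply, Function.comp_apply] at h1 h2 ⊢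
    rw [mul_add]
    linear_combination h1 + h2
  | mem_mul α hα i f hf ih =>
    obtain ⟨α, rfl⟩ := hα
    obtain ⟨g, hg, hfg, hg0⟩ := ih
    refine ⟨α.linear v • f + (α.comp (hyperplaneProj l v b)) * g, ?_, ?_, by simp⟩
    · refine add_mem (Submodule.smul_mem _ _ hf) ?_
      rcases Nat.eq_zero_or_pos i with rfl | hi
      · rw [hg0 rfl, mul_zero]
        exact zero_mem _
      · rw [Nat.succ_sub_one, show i = 1 + (i - 1) by omega]
        refine mul_mem_polyFun ?_ hg
        rw [polyFun, pow_one]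
        exact affine_mem_affineFunctions _
    · funext x
      have h1 := congrFun hfg x
      have h2 : α x = α (hyperplaneProj l v b x) + (l x - b) * α.linear v := by
        have : x = (l x - b) • v +ᵥ hyperplaneProj l v b x := by
          rw [hyperplaneProj_apply, vadd_eq_add]; abel
        conv_lhs => rw [this, AffineMap.map_vadd]
        simp [add_comm]
      simp only [Pi.add_apply, Pi.mul_apply, Pi.smul_apply, Function.comp_apply, smul_eq_mul,
        AffineMap.coe_comp] at h1 h2 ⊢
      linear_combination (f x) * h2 + α (hyperplaneProj l v b x) * h1

theorem exists_eq_mul_of_vanish {l : Module.Dual F V} (hl : l ≠ 0) {b : F} {u : ℕ}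
    {f : V → F} (hf : f ∈ polyFun F V u) (hb : ∀ x, l x = b → f x = 0) :
    ∃ g ∈ polyFun F V (u - 1), f = (fun x => l x - b) * g ∧ (u = 0 → g = 0) := by
  obtain ⟨v, hv⟩ := LinearMap.surjective hl 1
  obtain ⟨g, hg, hfg, hg0⟩ := exists_eq_comp_hyperplaneProj_add l v b hf
  have : f ∘ hyperplaneProj l v b = 0 := by
    funext x
    exact hb _ (by simp [hyperplaneProj_apply, hv])
  rw [this, zero_add] at hfg
  exact ⟨g, hg, hfg, hg0⟩

/-- Factors are split off one at a time: on `l = b` the factors already removed are nonzero, so the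
quotient still vanishes there. The last clause says that a nonzero function cannot vanish on more
than `u` parallel hyperplanes. -/
theorem exists_eq_prod_mul_of_vanish {l : Module.Dual F V} (hl : l ≠ 0) {u : ℕ}
    {f : V → F} (hf : f ∈ polyFun F V u) (B : Finset F) (hB : ∀ x, l x ∈ B → f x = 0) :
    ∃ g ∈ polyFun F V (u - B.card),
      f = (fun x => ∏ b ∈ B, (l x - b)) * g ∧ (u < B.card → g = 0) := by
  classical
  induction B using Finset.induction_on with
  | empty => exact ⟨f, by simpa using hf, by ext; simp, by simp⟩
  | insert b B hb ih =>
    obtain ⟨g, hg, rfl, hg0⟩ := ih fun x hx => hB x (Finset.mem_insert_of_mem hx)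
    have hgb : ∀ x, l x = b → g x = 0 := by
      intro x hx
      have h := hB x (by simp [hx])
      refine (mul_eq_zero.1 h).resolve_left ?_
      refine Finset.prod_ne_zero_iff.2 fun c hc => ?_
      rw [hx, sub_ne_zero]
      rintro rfl
      exact hb hc
    obtain ⟨g', hg', hgg', hg'0⟩ := exists_eq_mul_of_vanish hl hg hgb
    refine ⟨g', ?_, ?_, ?_⟩
    · rwa [Finset.card_insert_of_notMem hb, ← Nat.sub_sub]
    · rw [hgg']
      funext x
      simp only [Pi.mul_apply, Finset.prod_insert hb]
      ring
    · rw [Finset.card_insert_of_notMem hb]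
      intro h
      exact hg'0 (by omega)

end PolyFun

/-! ### Slicing by parallel hyperplanes and the weight bound -/

section Weight

/-- The number of points at which `f` does not vanish. -/
noncomputable def weight {V F : Type*} [Zero F] (f : V → F) : ℕ := Nat.card (Function.support f)

theorem weight_pos {V F : Type*} [Zero F] [Finite V] {f : V → F} (hf : f ≠ 0) : 0 < weight f := by
  have : Nonempty (Function.support f) := (Function.support_nonempty_iff.2 hf).to_subtype
  exact Nat.card_pos

theorem weight_zero {V F : Type*} [Zero F] : weight (0 : V → F) = 0 := by
  simp [weight]

variable {F V : Type*} [Field F] [AddCommGroup V] [Module F V]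

/-- The restriction of `f` to the hyperplane `l = a`, identified with `ker l` by means of a
vector `v` with `l v = 1`. -/
def slice (l : Module.Dual F V) (v : V) (f : V → F) (a : F) : LinearMap.ker l → F :=
  fun w => f (a • v + w)

theorem slice_mem_polyFun (l : Module.Dual F V) (v : V) {f : V → F} (a : F) {u : ℕ}
    (hf : f ∈ polyFun F V u) : slice l v f a ∈ polyFun F (LinearMap.ker l) u := by
  have h := comp_affine_mem_polyFun
    (AffineMap.const F _ (a • v) + (LinearMap.ker l).subtype.toAffineMap) hf
  convert h using 1
  funext w
  simp [slice]

theorem slice_apply_sub {l : Module.Dual F V} {v : V} (hv : l v = 1) (f : V → F) (x : V) :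
    slice l v f (l x) ⟨x - l x • v, by simp [hv]⟩ = f x := by
  simp [slice]

theorem slice_eq_zero_iff {l : Module.Dual F V} {v : V} (hv : l v = 1) (f : V → F) (a : F) :
    slice l v f a = 0 ↔ ∀ x, l x = a → f x = 0 := by
  constructor
  · rintro h x rfl
    rw [← slice_apply_sub hv f x, h, Pi.zero_apply]
  · intro h
    funext w
    exact h _ (by simp [hv])

theorem weight_slice {l : Module.Dual F V} {v : V} (hv : l v = 1) (f : V → F) (a : F) :
    weight (slice l v f a) = Nat.card {x // l x = a ∧ f x ≠ 0} := by
  refine Nat.card_congr (Equiv.ofBijective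
    (fun w => ⟨a • v + w.1, by simp [hv], w.2⟩) ⟨fun w w' h => ?_, fun x => ?_⟩)
  · have := congrArg Subtype.val h
    exact Subtype.ext (Subtype.ext (add_left_cancel this))
  · obtain ⟨x, rfl, hx⟩ := x
    refine ⟨⟨⟨x - l x • v, by simp [hv]⟩, ?_⟩, by simp⟩
    rw [Function.mem_support, slice_apply_sub hv]
    exact hx

theorem sum_weight_slice [Fintype F] [Finite V] {l : Module.Dual F V} {v : V} (hv : l v = 1)
    (f : V → F) : ∑ a, weight (slice l v f a) = weight f := by
  simp only [weight_slice hv]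
  rw [← Nat.card_sigma]
  refine Nat.card_congr (Equiv.ofBijective (fun p => ⟨p.2.1, p.2.2.2⟩) ⟨?_, fun x => ?_⟩)
  · rintro ⟨a, x, rfl, hx⟩ ⟨b, y, rfl, hy⟩ h
    obtain rfl : x = y := congrArg Subtype.val h
    rfl
  · exact ⟨⟨l x, x, rfl, x.2⟩, rfl⟩

open Classical in
/-- The values `a` such that `f` vanishes on the hyperplane `l = a`. -/
noncomputable def zeroSlices [Fintype F] (l : Module.Dual F V) (v : V) (f : V → F) : Finset F :=
  Finset.univ.filter fun a => slice l v f a = 0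

theorem mem_zeroSlices [Fintype F] {l : Module.Dual F V} {v : V} {f : V → F} {a : F} :
    a ∈ zeroSlices l v f ↔ slice l v f a = 0 := by
  simp [zeroSlices]

theorem dual_ne_zero {l : Module.Dual F V} {v : V} (hv : l v = 1) : l ≠ 0 := by
  rintro rfl
  simp at hv

theorem card_zeroSlices_lt [Fintype F] {l : Module.Dual F V} {v : V} (hv : l v = 1)
    {f : V → F} (hf : f ≠ 0) : (zeroSlices l v f).card < Fintype.card F := by
  refine lt_of_le_of_ne (Finset.card_le_univ _) fun h => hf ?_
  have := (Finset.card_eq_iff_eq_univ _).1 h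
  funext x
  have hx : l x ∈ zeroSlices l v f := by rw [this]; exact Finset.mem_univ _
  exact (slice_eq_zero_iff hv f _).1 (mem_zeroSlices.1 hx) x rfl

theorem card_zeroSlices_le [Fintype F] {l : Module.Dual F V} {v : V} (hv : l v = 1) {u : ℕ}
    {f : V → F} (hfu : f ∈ polyFun F V u) (hf : f ≠ 0) : (zeroSlices l v f).card ≤ u := by
  obtain ⟨g, -, hfg, hg0⟩ := exists_eq_prod_mul_of_vanish (dual_ne_zero hv) hfu (zeroSlices l v f)
    fun x hx => (slice_eq_zero_iff hv f _).1 (mem_zeroSlices.1 hx) x rfl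
  by_contra! h
  exact hf (by rw [hfg, hg0 h, mul_zero])

theorem slice_mem_polyFun_sub [Fintype F] {l : Module.Dual F V} {v : V} (hv : l v = 1) {u : ℕ}
    {f : V → F} (hfu : f ∈ polyFun F V u) (a : F) :
    slice l v f a ∈ polyFun F (LinearMap.ker l) (u - (zeroSlices l v f).card) := by
  obtain ⟨g, hg, hfg, -⟩ := exists_eq_prod_mul_of_vanish (dual_ne_zero hv) hfu (zeroSlices l v f)
    fun x hx => (slice_eq_zero_iff hv f _).1 (mem_zeroSlices.1 hx) x rfl
  -- On `l = a` the product of linear factors is a constant, so the slice is a multiple of a slice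
  -- of the quotient.
  have : slice l v f a = (∏ b ∈ zeroSlices l v f, (a - b)) • slice l v g a := by
    funext w
    have := congrFun hfg (a • v + w)
    simpa [slice, hv] using this
  rw [this]
  exact Submodule.smul_mem _ _ (slice_mem_polyFun l v a hg)

theorem finrank_ker_dual [Module.Finite F V] {l : Module.Dual F V} (hl : l ≠ 0) {m : ℕ}
    (hm : Module.finrank F V = m + 1) : Module.finrank F (LinearMap.ker l) = m := by
  have := Module.Dual.finrank_ker_add_one_of_ne_zero hl
  omega

theorem exists_dual_eq_one (F : Type*) {V : Type*} [Field F] [AddCommGroup V] [Module F V] {m : ℕ}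
    (hm : Module.finrank F V = m + 1) : ∃ (l : Module.Dual F V) (v : V), l v = 1 := by
  have : Nontrivial V := Module.nontrivial_of_finrank_pos (R := F) (by omega)
  obtain ⟨x, hx⟩ := exists_ne (0 : V)
  obtain ⟨l, hl⟩ := Module.Projective.exists_dual_eq_one F hx
  exact ⟨l, x, hl⟩

/-- A lower bound for the weight in terms of a bound on the nonzero slices. -/
theorem card_mul_le_weight [Fintype F] [Finite V] {l : Module.Dual F V} {v : V} (hv : l v = 1)
    (f : V → F) {d : ℕ} (h : ∀ a ∉ zeroSlices l v f, d ≤ weight (slice l v f a)) :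
    (Fintype.card F - (zeroSlices l v f).card) * d ≤ weight f := by
  classical
  rw [← sum_weight_slice hv, ← Finset.card_compl, ← smul_eq_mul]
  exact (Finset.card_nsmul_le_sum _ _ _ fun a ha => h a (Finset.mem_compl.1 ha)).trans
    (Finset.sum_le_univ_sum_of_nonneg fun _ => Nat.zero_le _)

theorem minDist_le_weight [Fintype F] (m : ℕ) : ∀ {V : Type*} [AddCommGroup V] [Module F V]
    [Finite V] {u : ℕ} {f : V → F}, Module.finrank F V = m → f ∈ polyFun F V u → f ≠ 0 →
    minDist (Fintype.card F) m u ≤ weight f := by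
  induction m with
  | zero => intro V _ _ _ u f _ _ hf; exact weight_pos hf
  | succ m ih =>
    intro V _ _ _ u f hm hfu hf
    obtain ⟨l, v, hv⟩ := exists_dual_eq_one F hm
    refine (minDist_le_mul m (card_zeroSlices_lt hv hf) (card_zeroSlices_le hv hfu hf)).trans
      (card_mul_le_weight hv f fun a ha => ?_)
    exact ih (finrank_ker_dual (dual_ne_zero hv) hm) (slice_mem_polyFun_sub hv hfu a)
      fun h => ha (mem_zeroSlices.2 h)

theorem minDist_eq_mul [Fintype F] [Finite V] {m u : ℕ} (hm : Module.finrank F V = m + 1)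
    {f : V → F} (hfu : f ∈ polyFun F V u) (hf : f ≠ 0)
    (hw : weight f = minDist (Fintype.card F) (m + 1) u) {l : Module.Dual F V} {v : V}
    (hv : l v = 1) :
    minDist (Fintype.card F) (m + 1) u =
      (Fintype.card F - (zeroSlices l v f).card) *
        minDist (Fintype.card F) m (u - (zeroSlices l v f).card) := by
  refine le_antisymm
    (minDist_le_mul m (card_zeroSlices_lt hv hf) (card_zeroSlices_le hv hfu hf)) ?_
  rw [← hw]
  exact card_mul_le_weight hv f fun a ha =>
    minDist_le_weight m (finrank_ker_dual (dual_ne_zero hv) hm) (slice_mem_polyFun_sub hv hfu a)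
      fun h => ha (mem_zeroSlices.2 h)

/-- When the total weight is minimal, every inequality in the slicing bound is an equality, so each
nonzero slice is itself of minimum weight. -/
theorem weight_slice_of_minDist [Fintype F] [Finite V] {m u : ℕ}
    (hm : Module.finrank F V = m + 1)
    {f : V → F} (hfu : f ∈ polyFun F V u) (hf : f ≠ 0)
    (hw : weight f = minDist (Fintype.card F) (m + 1) u) {l : Module.Dual F V} {v : V}
    (hv : l v = 1) {a : F} (ha : a ∉ zeroSlices l v f) :
    weight (slice l v f a) = minDist (Fintype.card F) m (u - (zeroSlices l v f).card) := by
  classical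
  have hle : ∀ a ∈ (zeroSlices l v f)ᶜ,
      minDist (Fintype.card F) m (u - (zeroSlices l v f).card) ≤ weight (slice l v f a) :=
    fun a ha => minDist_le_weight m (finrank_ker_dual (dual_ne_zero hv) hm)
      (slice_mem_polyFun_sub hv hfu a) fun h => Finset.mem_compl.1 ha (mem_zeroSlices.2 h)
  refine ((Finset.sum_eq_sum_iff_of_le hle).1 (le_antisymm (Finset.sum_le_sum hle) ?_) a
    (Finset.mem_compl.2 ha)).symm
  rw [Finset.sum_const, Finset.card_compl, smul_eq_mul, ← minDist_eq_mul hm hfu hf hw hv, ← hw,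
    ← sum_weight_slice hv]
  exact Finset.sum_le_univ_sum_of_nonneg fun _ => Nat.zero_le _

end Weight

/-! ### The support of a minimum weight function lies in a flat -/

section Structure

variable {F V : Type*} [Field F] [Fintype F] [AddCommGroup V] [Module F V]

theorem forall_support_of_card_zeroSlices {l : Module.Dual F V} {v : V} (hv : l v = 1) {f : V → F}
    (hk : (zeroSlices l v f).card = Fintype.card F - 1) : ∃ a, ∀ y, f y ≠ 0 → l y = a := by
  classical
  have hq : 1 < Fintype.card F := Fintype.one_lt_card
  have : (zeroSlices l v f)ᶜ.card = 1 := by rw [Finset.card_compl, hk]; omega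
  obtain ⟨a, ha⟩ := Finset.card_eq_one.1 this
  refine ⟨a, fun y hy => ?_⟩
  rw [← Finset.mem_singleton, ← ha, Finset.mem_compl, mem_zeroSlices]
  intro h
  exact hy ((slice_eq_zero_iff hv f _).1 h y rfl)

variable [Finite V]

theorem card_dual_apply_eq_zero {m : ℕ} (hm : Module.finrank F V = m + 1) {z : V}
    (hz : z ≠ 0) : Nat.card {l : Module.Dual F V // l z = 0} = Fintype.card F ^ m := by
  have hD : Module.finrank F (Module.Dual F V) = m + 1 := by rw [Subspace.dual_finrank_eq, hm]
  have : Finite (Module.Dual F V) := Module.finite_of_finite F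
  have hne : Module.Dual.eval F V z ≠ 0 := by
    rwa [Ne, Module.eval_apply_eq_zero_iff]
  rw [← Nat.card_eq_fintype_card, ← finrank_ker_dual hne hD]
  exact Module.natCard_eq_pow_finrank (V := LinearMap.ker (Module.Dual.eval F V z))

/-- Count pairs `(l, x)` with `x` in the support and `l x = l y`. Each `x ≠ y` lies in `q ^ m` of
them. If every nonzero `l` contributed exactly `weight f / q`, the contribution of `l = 0`, which is
all of `weight f`, would make the total too large. -/
theorem exists_dual_not_equidistributed {m : ℕ} (hm : Module.finrank F V = m + 1) {f : V → F}
    (hf : f ≠ 0) {y : V} (hy : f y = 0) :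
    ∃ l : Module.Dual F V, l ≠ 0 ∧
      Fintype.card F * Nat.card {x // l x = l y ∧ f x ≠ 0} ≠ weight f := by
  classical
  by_contra! h
  have : Finite (Module.Dual F V) := Module.finite_of_finite F
  have := Fintype.ofFinite (Module.Dual F V)
  have := Fintype.ofFinite (Function.support f)
  have hcard : Nat.card (Module.Dual F V) = Fintype.card F ^ (m + 1) := by
    rw [Module.natCard_eq_pow_finrank (K := F), Subspace.dual_finrank_eq, hm,
      Nat.card_eq_fintype_card]
  have h1 : ∑ l : Module.Dual F V, Nat.card {x // l x = l y ∧ f x ≠ 0}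
      = weight f * Fintype.card F ^ m := by
    rw [← Nat.card_sigma]
    have e : (Σ l : Module.Dual F V, {x // l x = l y ∧ f x ≠ 0}) ≃
        Σ x : Function.support f, {l : Module.Dual F V // l (x - y) = 0} :=
      { toFun := fun p => ⟨⟨p.2.1, p.2.2.2⟩, p.1, by simp [p.2.2.1]⟩
        invFun := fun p => ⟨p.2.1, p.1.1, by simpa [sub_eq_zero] using p.2.2, p.1.2⟩
        left_inv := fun p => rfl
        right_inv := fun p => rfl }
    rw [Nat.card_congr e, Nat.card_sigma, weight, Nat.card_eq_fintype_card, ← Finset.card_univ,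
      ← smul_eq_mul, ← Finset.sum_const]
    refine Finset.sum_congr rfl fun x _ => card_dual_apply_eq_zero hm ?_
    rw [sub_ne_zero]
    rintro h
    exact x.2 (by rw [h, hy])
  have h2 : ∑ l : Module.Dual F V, Fintype.card F * Nat.card {x // l x = l y ∧ f x ≠ 0}
      = Fintype.card F * weight f + (Fintype.card F ^ (m + 1) - 1) * weight f := by
    rw [← Finset.add_sum_erase _ _ (Finset.mem_univ 0)]
    congr 1
    · congr 1
      exact Nat.card_congr (Equiv.subtypeEquivRight fun x => by simp)
    · rw [Finset.sum_congr rfl fun l hl => h l (Finset.ne_of_mem_erase hl), Finset.sum_const,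
        Finset.card_erase_of_mem (Finset.mem_univ _), Finset.card_univ, ← Nat.card_eq_fintype_card,
        hcard, smul_eq_mul]
  rw [← Finset.mul_sum, h1] at h2
  have hw := weight_pos hf
  have hq : 1 < Fintype.card F := Fintype.one_lt_card
  obtain ⟨c, hc⟩ := Nat.exists_eq_add_of_le' (Nat.one_le_pow (m + 1) _ (zero_lt_one.trans hq))
  rw [hc, Nat.add_sub_cancel] at h2
  have h3 : Fintype.card F * (weight f * Fintype.card F ^ m) = weight f * (c + 1) := by
    rw [← hc]; ring
  nlinarith

/-- With no vanishing slice, all `q` slices of a form would have equal weight; this cannot happen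
for every form, given a zero of `f`. Such a zero exists because the minimum weight is below `q ^ (m
+ 1)` when `u > 0`. -/
theorem exists_zeroSlices_nonempty {m u : ℕ} (hm : Module.finrank F V = m + 1) {f : V → F}
    (hfu : f ∈ polyFun F V u) (hf : f ≠ 0)
    (hw : weight f = minDist (Fintype.card F) (m + 1) u) (hu : 0 < u) :
    ∃ (l : Module.Dual F V) (v : V), l v = 1 ∧ (zeroSlices l v f).card ≠ 0 := by
  have hlt := minDist_lt_pow (Fintype.one_lt_card (α := F)) m hu
  obtain ⟨y, hy⟩ : ∃ y, f y = 0 := by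
    by_contra! h
    rw [← hw, ← hm, ← Nat.card_eq_fintype_card, ← Module.natCard_eq_pow_finrank] at hlt
    refine hlt.ne (Nat.card_congr (Equiv.subtypeUnivEquiv h))
  obtain ⟨l, hl, hne⟩ := exists_dual_not_equidistributed hm hf hy
  obtain ⟨v, hv⟩ := LinearMap.surjective hl 1
  refine ⟨l, v, hv, fun h0 => hne ?_⟩
  have hmul := minDist_eq_mul hm hfu hf hw hv
  rw [← weight_slice hv, weight_slice_of_minDist hm hfu hf hw hv, hw, hmul, h0, Nat.sub_zero,
    Nat.sub_zero]
  rw [Finset.card_eq_zero.1 h0]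
  exact Finset.notMem_empty _

theorem card_zeroSlices_cases {m t s : ℕ} (hm : Module.finrank F V = m + 1)
    (hs : s < Fintype.card F - 1)
    (hu : t * (Fintype.card F - 1) + s < (m + 1) * (Fintype.card F - 1)) {f : V → F}
    (hfu : f ∈ polyFun F V (t * (Fintype.card F - 1) + s)) (hf : f ≠ 0)
    (hw : weight f = minDist (Fintype.card F) (m + 1) (t * (Fintype.card F - 1) + s))
    {l : Module.Dual F V} {v : V} (hv : l v = 1) :
    (zeroSlices l v f).card = 0 ∨ (zeroSlices l v f).card = s ∨
      (zeroSlices l v f).card = Fintype.card F - 1 := by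
  have := eq_of_minDist_eq_mul m (card_zeroSlices_lt hv hf) (card_zeroSlices_le hv hfu hf) hu
    (minDist_eq_mul hm hfu hf hw hv)
  rwa [Nat.mul_add_mod_self_right, Nat.mod_eq_of_lt hs] at this

theorem exists_hyperplane_of_minDist {m t s : ℕ} (hm : Module.finrank F V = m + 1)
    (hs : s < Fintype.card F - 1)
    (hu : (t + 1) * (Fintype.card F - 1) + s ≤ (m + 1) * (Fintype.card F - 1)) {f : V → F}
    (hfu : f ∈ polyFun F V ((t + 1) * (Fintype.card F - 1) + s)) (hf : f ≠ 0)
    (hw : weight f = minDist (Fintype.card F) (m + 1) ((t + 1) * (Fintype.card F - 1) + s))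
    (ih : ∀ l : Module.Dual F V, l ≠ 0 → ∀ g : LinearMap.ker l → F, t + 1 ≤ m →
      g ∈ polyFun F (LinearMap.ker l) ((t + 1) * (Fintype.card F - 1)) → g ≠ 0 →
      weight g = minDist (Fintype.card F) m ((t + 1) * (Fintype.card F - 1)) →
      ∃ (W : Submodule F (LinearMap.ker l)) (x : LinearMap.ker l),
        Module.finrank F W + (t + 1) = m ∧ ∀ w ∈ W, g (x + w) ≠ 0) :
    ∃ (l : Module.Dual F V) (v : V) (a : F), l v = 1 ∧ ∀ y, f y ≠ 0 → l y = a := by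
  classical
  have hq : 1 < Fintype.card F := Fintype.one_lt_card
  rcases hu.eq_or_lt with hu | hu
  -- At the top degree the minimum weight is 1, so the support is a single point and any form will
  -- do.
  · obtain ⟨l, v, hv⟩ := exists_dual_eq_one F hm
    rw [hu, ← add_zero ((m + 1) * _), minDist_add le_rfl, Nat.sub_self, minDist, weight,
      Nat.card_eq_one_iff_unique] at hw
    obtain ⟨h1, ⟨x⟩⟩ := hw
    exact ⟨l, v, l x, hv, fun y hy =>
      congrArg (fun z : Function.support f => l z) (h1.elim ⟨y, hy⟩ x)⟩
  have htm : t + 1 ≤ m := by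
    have := (Nat.mul_lt_mul_right (show 0 < Fintype.card F - 1 by omega)).1
      (lt_of_le_of_lt (Nat.le_add_right _ s) hu)
    omega
  obtain ⟨l, v, hv, hk0⟩ := exists_zeroSlices_nonempty hm hfu hf hw (by
    have : 0 < (t + 1) * (Fintype.card F - 1) := Nat.mul_pos (by omega) (by omega)
    omega)
  rcases card_zeroSlices_cases hm hs hu hfu hf hw hv with hk | hk | hk
  · exact absurd hk hk0
  -- Since `s < q - 1`, at least two slices survive; one supplies a flat in the support, the other
  -- an extra point `p`.
  · have hcompl : 1 < (zeroSlices l v f)ᶜ.card := by rw [Finset.card_compl, hk]; omega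
    obtain ⟨a, ha, b, hb, hab⟩ := Finset.one_lt_card.1 hcompl
    rw [Finset.mem_compl] at ha hb
    have hga : slice l v f a ≠ 0 := fun h => ha (mem_zeroSlices.2 h)
    have hwa := weight_slice_of_minDist hm hfu hf hw hv ha
    have hpa := slice_mem_polyFun_sub hv hfu a
    rw [hk, Nat.add_sub_cancel] at hwa hpa
    obtain ⟨W, x, hW, hWx⟩ := ih l (dual_ne_zero hv) _ htm hpa hga hwa
    obtain ⟨p, hpb, hp⟩ : ∃ p, l p = b ∧ f p ≠ 0 := by
      rw [mem_zeroSlices, slice_eq_zero_iff hv] at hb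
      push Not at hb
      exact hb
    set z : V := a • v + x with hz
    -- `Q` has dimension at most `m - t`, so it lies in the kernel of some nonzero `l'`; one
    -- hyperplane of `l'` then contains both the flat `z + W` and `p`.
    set Q : Submodule F V := W.map (LinearMap.ker l).subtype ⊔ F ∙ (p - z) with hQ
    have hQlt : Q < ⊤ := by
      refine Submodule.lt_top_of_finrank_lt_finrank ?_
      have h1 := Submodule.finrank_add_le_finrank_add_finrank
        (W.map (LinearMap.ker l).subtype) (F ∙ (p - z))
      have h2 : Module.finrank F (F ∙ (p - z)) = 1 := by
        refine finrank_span_singleton (K := F) (show p - z ≠ 0 from fun h => hab ?_)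
        rw [sub_eq_zero] at h
        rw [← hpb, h]
        simp [hz, hv]
      have h3 := Submodule.finrank_map_le (LinearMap.ker l).subtype W
      rw [← hQ] at h1
      omega
    obtain ⟨l', hl', hQl'⟩ := Submodule.exists_le_ker_of_lt_top Q hQlt
    obtain ⟨v', hv'⟩ := LinearMap.surjective hl' 1
    have hzp : l' z = l' p := by
      have : p - z ∈ LinearMap.ker l' :=
        hQl' (Submodule.mem_sup_right (Submodule.mem_span_singleton_self _))
      rw [LinearMap.mem_ker, map_sub, sub_eq_zero] at this
      exact this.symm
    have hWl' : ∀ w ∈ W, l' (w : V) = 0 := fun w hw =>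
      hQl' (Submodule.mem_sup_left (Submodule.mem_map_of_mem hw))
    have hcount : Nat.card W + 1 ≤ weight (slice l' v' f (l' p)) := by
      rw [weight_slice hv', ← Finite.card_option]
      let φ : Option W → {y // l' y = l' p ∧ f y ≠ 0} := fun o => o.elim ⟨p, rfl, hp⟩ fun w =>
        ⟨z + w.1, by rw [map_add, hWl' _ w.2, add_zero, hzp], by
          have := hWx w.1 w.2
          rwa [slice, Submodule.coe_add, ← add_assoc] at this⟩
      have hlz : ∀ w : W, l (z + w.1) = a := fun w => by simp [hz, hv]
      refine Nat.card_le_card_of_injective φ ?_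
      rintro (_ | w) (_ | w') h
      · rfl
      · have := congrArg (fun y => l y.1) h
        simp only [φ, Option.elim, hlz, hpb] at this
        exact absurd this.symm hab
      · have := congrArg (fun y => l y.1) h
        simp only [φ, Option.elim, hlz, hpb] at this
        exact absurd this hab
      · have := congrArg Subtype.val h
        simp only [φ, Option.elim, add_right_inj] at this
        exact congrArg some (Subtype.ext (Subtype.ext this))
    have hp' : l' p ∉ zeroSlices l' v' f := by
      rw [mem_zeroSlices, slice_eq_zero_iff hv']
      exact fun h => hp (h p rfl)
    have hwp := weight_slice_of_minDist hm hfu hf hw hv' hp'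
    have hmul := minDist_eq_mul hm hfu hf hw hv'
    rw [← hwp, minDist_add (by omega), show m + 1 - (t + 1) = (m - (t + 1)) + 1 by omega,
      minDist_of_lt hs] at hmul
    rw [Module.natCard_eq_pow_finrank (K := F), Nat.card_eq_fintype_card,
      show Module.finrank F W = m - (t + 1) by omega] at hcount
    -- With `k'` vanishing slices for `l'`, the total weight `(q - s) * q ^ (m - (t + 1))` is `q -
    -- k'` times a slice weight exceeding `q ^ (m - (t + 1))`, so `k' > s` and only `q - 1` remains.
    have hbig : ¬ (zeroSlices l' v' f).card ≤ s := by
      intro hle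
      have h1 := Nat.mul_le_mul (Nat.sub_le_sub_left hle (Fintype.card F)) hcount
      rw [← hmul, mul_add] at h1
      omega
    rcases card_zeroSlices_cases hm hs hu hfu hf hw hv' with hk' | hk' | hk'
    · omega
    · omega
    · obtain ⟨c, hc⟩ := forall_support_of_card_zeroSlices hv' hk'
      exact ⟨l', v', c, hv', hc⟩
  · obtain ⟨c, hc⟩ := forall_support_of_card_zeroSlices hv hk
    exact ⟨l, v, c, hv, hc⟩

theorem exists_flat_of_minDist (m : ℕ) : ∀ {V : Type*} [AddCommGroup V] [Module F V] [Finite V]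
    {t s : ℕ} {f : V → F}, Module.finrank F V = m → s < Fintype.card F - 1 →
    t * (Fintype.card F - 1) + s ≤ m * (Fintype.card F - 1) →
    f ∈ polyFun F V (t * (Fintype.card F - 1) + s) → f ≠ 0 →
    weight f = minDist (Fintype.card F) m (t * (Fintype.card F - 1) + s) →
    ∃ (W : Submodule F V) (x : V), Module.finrank F W + t = m ∧ (∀ y, f y ≠ 0 → y - x ∈ W) ∧
      (fun w : W => f (x + w)) ∈ polyFun F W s := by
  induction m with
  | zero =>
    intro V _ _ _ t s f hm hs hu hfu hf hw
    obtain ⟨h1, rfl⟩ : t * (Fintype.card F - 1) = 0 ∧ s = 0 := by omega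
    obtain rfl : t = 0 := (Nat.mul_eq_zero.1 h1).resolve_right (by omega)
    refine ⟨⊤, 0, by simp [hm], fun _ _ => Submodule.mem_top, ?_⟩
    have := comp_affine_mem_polyFun (⊤ : Submodule F V).subtype.toAffineMap hfu
    simpa [Function.comp_def] using this
  | succ m ih =>
    intro V _ _ _ t s f hm hs hu hfu hf hw
    cases t with
    | zero =>
      refine ⟨⊤, 0, by simp [hm], fun _ _ => Submodule.mem_top, ?_⟩
      have := comp_affine_mem_polyFun (⊤ : Submodule F V).subtype.toAffineMap hfu
      simpa [Function.comp_def] using this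
    | succ t =>
      -- The hypothesis on slices comes from the induction with `s = 0`: there the function is
      -- constant on its flat, hence nowhere zero on it.
      obtain ⟨l, v, a, hv, ha⟩ := exists_hyperplane_of_minDist hm hs hu hfu hf hw (by
        intro l hl g htm hgu hg hgw
        obtain ⟨W, x, hW, hWx, hWg⟩ := ih (s := 0) (finrank_ker_dual hl hm) (by omega)
          (Nat.mul_le_mul_right _ htm) hgu hg hgw
        obtain ⟨c, hc⟩ := mem_polyFun_zero.1 hWg
        refine ⟨W, x, hW, fun w hw => ?_⟩
        obtain ⟨y, hy⟩ := Function.ne_iff.1 hg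
        have h1 := congrFun hc ⟨w, hw⟩
        have h2 := congrFun hc ⟨y - x, hWx y hy⟩
        simp only [add_sub_cancel] at h1 h2
        rw [h1, ← h2]
        exact hy)
      have hka : a ∉ zeroSlices l v f := by
        rw [mem_zeroSlices, slice_eq_zero_iff hv]
        intro h
        refine hf (funext fun y => ?_)
        by_contra hy
        exact hy (h y (ha y hy))
      have hk : (zeroSlices l v f).card = Fintype.card F - 1 := by
        classical
        rw [show zeroSlices l v f = Finset.univ.erase a from ?_,
          Finset.card_erase_of_mem (Finset.mem_univ a), Finset.card_univ]
        ext b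
        simp only [Finset.mem_erase, Finset.mem_univ, and_true]
        refine ⟨fun hb h => hka (h ▸ hb), fun hb => ?_⟩
        rw [mem_zeroSlices, slice_eq_zero_iff hv]
        intro y hy
        by_contra hy'
        exact hb (hy.symm.trans (ha y hy'))
      have hwa := weight_slice_of_minDist hm hfu hf hw hv hka
      have hpa := slice_mem_polyFun_sub hv hfu a
      -- Restricting to the hyperplane uses up `q - 1` degrees, so `t` drops by one together with
      -- the dimension.
      have e : (t + 1) * (Fintype.card F - 1) + s - (Fintype.card F - 1) =
        t * (Fintype.card F - 1) + s := by
        rw [add_mul, one_mul]; omega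
      rw [hk, e] at hwa hpa
      obtain ⟨W, x, hW, hWx, hWf⟩ := ih (finrank_ker_dual (dual_ne_zero hv) hm) hs
        (by rw [add_mul, add_mul, one_mul] at hu; omega) hpa
        (fun h => hka (mem_zeroSlices.2 h)) hwa
      let φ := W.equivMapOfInjective (LinearMap.ker l).subtype (Submodule.subtype_injective _)
      refine ⟨W.map (LinearMap.ker l).subtype, a • v + x, ?_, ?_, ?_⟩
      · rw [← φ.finrank_eq]; omega
      · intro y hy
        have hly := ha y hy
        refine ⟨⟨y - a • v, by simp [hv, hly]⟩ - x, hWx _ ?_, ?_⟩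
        · simpa [slice] using hy
        · simp [sub_sub]
      · have := comp_affine_mem_polyFun φ.symm.toLinearMap.toAffineMap hWf
        convert this using 1
        funext w
        obtain ⟨w, rfl⟩ := φ.surjective w
        simp [slice, φ, add_assoc]

end Structure

/-! ### Minimum weight functions of degree `s < q - 1` -/

section MinFun

variable (F V : Type*) [Field F] [Fintype F] [AddCommGroup V] [Module F V]

/-- The nonzero functions of degree at most `u` on `V` of the smallest possible weight. -/
def minFun (u : ℕ) : Set (V → F) :=
  {f | f ∈ polyFun F V u ∧ f ≠ 0 ∧ weight f = minDist (Fintype.card F) (Module.finrank F V) u}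

variable {F V}

/-- The zero set determines the line of `l`. If some `w` were killed by `l'` but not by `l`, moving
along `w` from a point with `l'`-value outside `B'` would reach a zero of the left side only. -/
theorem eq_of_prod_eq {l l' : Module.Dual F V} {B B' : Finset F} {c c' : F} (hc : c ≠ 0)
    (hc' : c' ≠ 0) (hB : B.Nonempty) (hB' : B'.card < Fintype.card F) (hl' : l' ≠ 0)
    (h : (fun x => c * ∏ b ∈ B, (l x - b)) = fun x => c' * ∏ b ∈ B', (l' x - b)) :
    l ∈ Submodule.span F {l'} := by
  have hiff : ∀ x, l x ∈ B ↔ l' x ∈ B' := by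
    intro x
    have h1 := congrArg (· = 0) (congrFun h x)
    simpa [hc, hc', Finset.prod_eq_zero_iff, sub_eq_zero] using h1
  have hker : LinearMap.ker l' ≤ LinearMap.ker l := by
    intro w hw
    by_contra hlw
    rw [LinearMap.mem_ker] at hw hlw
    obtain ⟨b, hb⟩ := hB
    obtain ⟨a, ha⟩ : ∃ a, a ∉ B' := by
      by_contra! hall
      exact hB'.ne ((Finset.card_eq_iff_eq_univ _).2 (Finset.eq_univ_iff_forall.2 hall))
    obtain ⟨x, rfl⟩ := LinearMap.surjective hl' a
    have h1 := hiff (x + ((b - l x) / l w) • w)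
    simp [hw, hlw, ha, hb] at h1
  have := mem_span_of_iInf_ker_le_ker (ι := Unit) (L := fun _ => l') (K := l) (by simpa using hker)
  simpa using this

variable [Finite V]

theorem exists_eq_prod_of_mem_minFun {r s : ℕ} (hr : Module.finrank F V = r + 1)
    (hs : s < Fintype.card F - 1) (hs0 : 0 < s) {f : V → F} (hf : f ∈ minFun F V s) :
    ∃ (l : Module.Dual F V) (B : Finset F) (c : F), l ≠ 0 ∧ B.card = s ∧ c ≠ 0 ∧
      f = fun x => c * ∏ b ∈ B, (l x - b) := by
  obtain ⟨hfu, hf0, hw⟩ := hf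
  rw [hr] at hw
  obtain ⟨l, v, hv, hk0⟩ := exists_zeroSlices_nonempty hr hfu hf0 hw hs0
  have hk : (zeroSlices l v f).card = s := by
    have hle := card_zeroSlices_le hv hfu hf0
    have hlt : 0 * (Fintype.card F - 1) + s < (r + 1) * (Fintype.card F - 1) := by
      rw [add_mul]; omega
    have := card_zeroSlices_cases (t := 0) hr hs hlt (by simpa using hfu) hf0
      (by simpa using hw) hv
    omega
  obtain ⟨g, hg, hfg, -⟩ := exists_eq_prod_mul_of_vanish (dual_ne_zero hv) hfu (zeroSlices l v f)
    fun x hx => (slice_eq_zero_iff hv f _).1 (mem_zeroSlices.1 hx) x rfl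
  -- All `s` degrees are used by the linear factors, so the quotient is constant.
  rw [hk, Nat.sub_self] at hg
  obtain ⟨c, rfl⟩ := mem_polyFun_zero.1 hg
  refine ⟨l, _, c, dual_ne_zero hv, hk, ?_, ?_⟩
  · rintro rfl
    exact hf0 (hfg.trans (by ext; simp))
  · refine hfg.trans (funext fun x => ?_)
    exact mul_comm _ _

theorem prod_mem_minFun {r : ℕ} (hr : Module.finrank F V = r + 1) {l : Module.Dual F V}
    (hl : l ≠ 0) {B : Finset F} (hB : B.card < Fintype.card F - 1) {c : F} (hc : c ≠ 0) :
    (fun x => c * ∏ b ∈ B, (l x - b)) ∈ minFun F V B.card := by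
  classical
  obtain ⟨v, hv⟩ := LinearMap.surjective hl 1
  have hw : weight (fun x => c * ∏ b ∈ B, (l x - b)) = (Fintype.card F - B.card) *
      Fintype.card F ^ r := by
    rw [← sum_weight_slice hv, ← Finset.card_compl, ← smul_eq_mul, ← Finset.sum_const,
      ← Finset.sum_subset (Finset.subset_univ Bᶜ)]
    · refine Finset.sum_congr rfl fun a ha => ?_
      rw [← finrank_ker_dual hl hr, ← Nat.card_eq_fintype_card,
        ← Module.natCard_eq_pow_finrank]
      refine Nat.card_congr (Equiv.subtypeUnivEquiv fun w => ?_)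
      simp only [slice, Function.mem_support, map_add, map_smul, hv, LinearMap.map_coe_ker]
      refine mul_ne_zero hc (Finset.prod_ne_zero_iff.2 fun b hb => ?_)
      rw [smul_eq_mul, mul_one, add_zero, sub_ne_zero]
      rintro rfl
      exact Finset.mem_compl.1 ha hb
    · intro a _ ha
      rw [Finset.mem_compl, not_not] at ha
      rw [(slice_eq_zero_iff hv _ a).2, weight_zero]
      rintro x rfl
      exact mul_eq_zero_of_right _ (Finset.prod_eq_zero ha (sub_self _))
  have hpos : 0 < (Fintype.card F - B.card) * Fintype.card F ^ r :=
    Nat.mul_pos (by omega) (pow_pos Fintype.card_pos _)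
  refine ⟨?_, ?_, ?_⟩
  · have := prod_mem_polyFun B fun b _ => dual_sub_mem_polyFun l b
    rw [mul_one] at this
    convert Submodule.smul_mem _ c this using 1
    funext x
    simp
  · intro h
    rw [h, weight_zero] at hw
    omega
  · rw [hw, hr, minDist_of_lt hB]

theorem minDist_zero {q : ℕ} (hq : 1 < q) (r : ℕ) : minDist q r 0 = q ^ r := by
  cases r with
  | zero => simp [minDist]
  | succ r => rw [minDist_of_lt (by omega), Nat.sub_zero, pow_succ']

theorem mem_minFun_zero {f : V → F} : f ∈ minFun F V 0 ↔ ∃ c : Fˣ, f = fun _ => (c : F) := by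
  constructor
  · rintro ⟨hf, hf0, -⟩
    obtain ⟨c, rfl⟩ := mem_polyFun_zero.1 hf
    exact ⟨Units.mk0 c (by rintro rfl; exact hf0 rfl), rfl⟩
  · rintro ⟨c, rfl⟩
    refine ⟨const_mem_polyFun _ 0, fun h => c.ne_zero (congrFun h 0), ?_⟩
    rw [minDist_zero Fintype.one_lt_card, ← Nat.card_eq_fintype_card,
      ← Module.natCard_eq_pow_finrank]
    exact Nat.card_congr (Equiv.subtypeUnivEquiv fun _ => c.ne_zero)

theorem card_minFun_zero : Nat.card (minFun F V 0) = Fintype.card F - 1 := by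
  classical
  rw [← Fintype.card_units, ← Nat.card_eq_fintype_card]
  refine (Nat.card_congr (Equiv.ofBijective
    (fun c : Fˣ => (⟨fun _ => c, mem_minFun_zero.2 ⟨c, rfl⟩⟩ : minFun F V 0))
    ⟨fun c d h => ?_, fun f => ?_⟩)).symm
  · exact Units.ext (congrFun (congrArg Subtype.val h) 0)
  · obtain ⟨f, hf⟩ := f
    obtain ⟨c, rfl⟩ := mem_minFun_zero.1 hf
    exact ⟨c, rfl⟩

theorem card_submodule_eq_qBinomial {F V : Type*} [Field F] [AddCommGroup V] [Module F V]
    [Module.Finite F V] {n : ℕ} (hn : Module.finrank F V = n) (k : ℕ) :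
    Nat.card {W : Submodule F V // Module.finrank F W = k} = qBinomial F n k := by
  let e : V ≃ₗ[F] (Fin n → F) := LinearEquiv.ofFinrankEq _ _ (by simp [hn])
  refine Nat.card_congr ((Submodule.orderIsoMapComap e).toEquiv.subtypeEquiv fun W => ?_)
  change _ ↔ Module.finrank F (W.map (e : V →ₗ[F] (Fin n → F))) = k
  rw [LinearEquiv.finrank_map_eq]

/-- Passing to annihilators turns codimension `t` in `V` into dimension `t` in the dual. -/
theorem card_submodule_add_eq_qBinomial {F V : Type*} [Field F] [AddCommGroup V] [Module F V]
    [Module.Finite F V] {n : ℕ} (hn : Module.finrank F V = n) (t : ℕ) :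
    Nat.card {W : Submodule F V // Module.finrank F W + t = n} = qBinomial F n t := by
  rw [← card_submodule_eq_qBinomial (V := Module.Dual F V) (by rw [Subspace.dual_finrank_eq, hn])]
  refine Nat.card_congr ((Subspace.orderIsoFiniteDimensional (K := F) (V := V)).toEquiv.trans
    OrderDual.ofDual |>.subtypeEquiv fun W => ?_)
  change _ ↔ Module.finrank F W.dualAnnihilator = t
  have := Subspace.finrank_add_finrank_dualAnnihilator_eq W
  omega

theorem card_minFun {r s : ℕ} (hr : Module.finrank F V = r + 1)
    (hs : s < Fintype.card F - 1) (hs0 : 0 < s) :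
    Nat.card (minFun F V s) =
      (Fintype.card F - 1) * qBinomial F (r + 1) 1 * (Fintype.card F).choose s := by
  classical
  have hD : Module.finrank F (Module.Dual F V) = r + 1 := by rw [Subspace.dual_finrank_eq, hr]
  have hgen : ∀ L : {L : Submodule F (Module.Dual F V) // Module.finrank F L = 1},
      ∃ l : Module.Dual F V, l ≠ 0 ∧ L.1 = Submodule.span F {l} := by
    rintro ⟨L, hL⟩
    obtain ⟨l, hl, hl0⟩ := Submodule.exists_mem_ne_zero_of_ne_bot (p := L) (by
      rintro rfl
      simp at hL)
    refine ⟨l, hl0, (Submodule.eq_of_le_of_finrank_eq ?_ ?_).symm⟩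
    · rwa [Submodule.span_singleton_le_iff_mem]
    · rw [finrank_span_singleton hl0, hL]
  -- A fixed generator of each line in the dual makes the pair `(c, B)` unique.
  choose gen hgen0 hgen using hgen
  rw [← card_submodule_eq_qBinomial hD, mul_comm (Fintype.card F - 1), mul_assoc,
    ← Fintype.card_units, ← Fintype.card_finset_len, ← Nat.card_eq_fintype_card,
    ← Nat.card_eq_fintype_card, ← Nat.card_prod, ← Nat.card_prod]
  refine (Nat.card_congr (Equiv.ofBijective
    (fun p => (⟨fun x => (p.2.1 : F) * ∏ b ∈ p.2.2.1, (gen p.1 x - b), ?_⟩ : minFun F V s))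
    ⟨?_, ?_⟩)).symm
  · have := prod_mem_minFun hr (hgen0 p.1) (B := p.2.2.1) (by rw [p.2.2.2]; exact hs)
      p.2.1.ne_zero
    rwa [p.2.2.2] at this
  · rintro ⟨L, c, B, hB⟩ ⟨L', c', B', hB'⟩ h
    have h := congrArg Subtype.val h
    simp only at h
    have hmem := eq_of_prod_eq c.ne_zero c'.ne_zero (Finset.card_pos.1 (by omega)) (by omega)
      (hgen0 L') h
    obtain rfl : L = L' := by
      refine Subtype.ext (Submodule.eq_of_le_of_finrank_eq ?_ (by rw [L.2, L'.2]))
      rw [hgen L, hgen L', Submodule.span_singleton_le_iff_mem]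
      exact hmem
    obtain rfl : B = B' := by
      ext a
      obtain ⟨x, rfl⟩ := LinearMap.surjective (hgen0 L) a
      have h1 := congrArg (· = 0) (congrFun h x)
      simpa [Finset.prod_eq_zero_iff, sub_eq_zero] using h1
    obtain ⟨a, ha⟩ : ∃ a, a ∉ B := by
      by_contra! hall
      have := (Finset.card_eq_iff_eq_univ _).2 (Finset.eq_univ_iff_forall.2 hall)
      omega
    obtain ⟨x, rfl⟩ := LinearMap.surjective (hgen0 L) a
    have hne : ∏ b ∈ B, (gen L x - b) ≠ 0 := by
      refine Finset.prod_ne_zero_iff.2 fun b hb => sub_ne_zero.2 ?_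
      rintro rfl
      exact ha hb
    have h2 := mul_right_cancel₀ hne (congrFun h x)
    rw [Units.ext h2]
  · rintro ⟨f, hf⟩
    obtain ⟨l, B, c, hl, hB, hc, rfl⟩ := exists_eq_prod_of_mem_minFun hr hs hs0 hf
    let L : {L : Submodule F (Module.Dual F V) // Module.finrank F L = 1} :=
      ⟨Submodule.span F {l}, finrank_span_singleton hl⟩
    have hlL : l ∈ Submodule.span F {gen L} := by
      rw [← hgen L]
      exact Submodule.mem_span_singleton_self l
    obtain ⟨α, hα⟩ := Submodule.mem_span_singleton.1 hlL
    have hα0 : α ≠ 0 := by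
      rintro rfl
      exact hl (by rw [← hα, zero_smul])
    have hinj : Function.Injective fun b : F => α⁻¹ * b := mul_right_injective₀ (inv_ne_zero hα0)
    -- With `l = α • gen L`, pulling `α` out of each of the `s` factors rescales `c` by `α ^ s` and
    -- the roots by `α⁻¹`.
    refine ⟨⟨L, Units.mk0 (c * α ^ s) (mul_ne_zero hc (pow_ne_zero _ hα0)),
      B.image fun b => α⁻¹ * b, by rw [Finset.card_image_of_injective _ hinj, hB]⟩, ?_⟩
    refine Subtype.ext (funext fun x => ?_)
    simp only [Units.val_mk0]
    rw [Finset.prod_image fun a _ b _ h => hinj h, mul_assoc, ← hB, ← Finset.prod_const,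
      ← Finset.prod_mul_distrib]
    congr 1
    refine Finset.prod_congr rfl fun b _ => ?_
    rw [← hα, mul_sub, mul_inv_cancel_left₀ hα0, LinearMap.smul_apply, smul_eq_mul]

end MinFun

/-! ### Extension by zero from flats, and the count over flats -/

section Flats

variable {F V : Type*} [Field F] [AddCommGroup V] [Module F V]

open Classical in
/-- The extension by zero of a function `g` on `W` to `V`, after a translation by `x`. -/
noncomputable def extendFlat (W : Submodule F V) (x : V) (g : W → F) : V → F :=
  fun y => if h : y - x ∈ W then g ⟨y - x, h⟩ else 0

theorem extendFlat_add (W : Submodule F V) (x : V) (g : W → F) (w : W) :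
    extendFlat W x g (x + w) = g w := by
  simp [extendFlat]

theorem sub_mem_of_extendFlat_ne_zero {W : Submodule F V} {x : V} {g : W → F} {y : V}
    (h : extendFlat W x g y ≠ 0) : y - x ∈ W := by
  by_contra hy
  exact h (dif_neg hy)

theorem weight_extendFlat (W : Submodule F V) (x : V) (g : W → F) :
    weight (extendFlat W x g) = weight g := by
  have hmem : ∀ w : Function.support g, x + w.1 ∈ Function.support (extendFlat W x g) := by
    intro w
    rw [Function.mem_support, extendFlat_add]
    exact w.2
  refine (Nat.card_congr (Equiv.ofBijective (fun w => ⟨x + w.1, hmem w⟩)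
    ⟨fun w w' h => ?_, ?_⟩)).symm
  · exact Subtype.ext (Subtype.ext (add_left_cancel (congrArg Subtype.val h)))
  · rintro ⟨y, hy⟩
    have hyx := sub_mem_of_extendFlat_ne_zero hy
    refine ⟨⟨⟨y - x, hyx⟩, ?_⟩, by simp⟩
    have := extendFlat_add W x g ⟨y - x, hyx⟩
    rw [add_sub_cancel] at this
    rw [Function.mem_support, ← this]
    exact hy

theorem extendFlat_ne_zero {W : Submodule F V} {x : V} {g : W → F} (hg : g ≠ 0) :
    extendFlat W x g ≠ 0 := by
  obtain ⟨w, hw⟩ := Function.ne_iff.1 hg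
  refine Function.ne_iff.2 ⟨x + w, ?_⟩
  rwa [extendFlat_add]

theorem extendFlat_eq_self {W : Submodule F V} {x : V} {f : V → F}
    (hf : ∀ y, f y ≠ 0 → y - x ∈ W) : extendFlat W x (fun w => f (x + w)) = f := by
  funext y
  by_cases hy : y - x ∈ W
  · simp [extendFlat, hy]
  · rw [extendFlat, dif_neg hy]
    by_contra h
    exact hy (hf y (Ne.symm h))

-- `W` is cut out by `t` linear forms `ψ i`, and its indicator is the product of the `1 - ψ i ^ (q -
-- 1)`.
open Classical in
theorem indicator_mem_polyFun [Fintype F] [Module.Finite F V] (W : Submodule F V) {t : ℕ}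
    (ht : Module.finrank F W + t = Module.finrank F V) :
    (fun y => if y ∈ W then (1 : F) else 0) ∈ polyFun F V (t * (Fintype.card F - 1)) := by
  have hq : 1 < Fintype.card F := Fintype.one_lt_card
  have hquot : Module.finrank F (V ⧸ W) = t := by
    have := W.finrank_quotient_add_finrank
    omega
  let e : (V ⧸ W) ≃ₗ[F] (Fin t → F) := LinearEquiv.ofFinrankEq _ _ (by simp [hquot])
  let ψ : Fin t → Module.Dual F V := fun i => LinearMap.proj i ∘ₗ e.toLinearMap ∘ₗ W.mkQ
  have hψ : ∀ y, y ∈ W ↔ ∀ i, ψ i y = 0 := by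
    intro y
    rw [← Submodule.Quotient.mk_eq_zero, ← e.map_eq_zero_iff, funext_iff]
    rfl
  have hmem : ∏ i, ((fun _ => 1) - (fun y => ψ i y - 0) ^ (Fintype.card F - 1)) ∈
      polyFun F V (t * (Fintype.card F - 1)) := by
    have := prod_mem_polyFun (V := V) (F := F) (Finset.univ : Finset (Fin t))
      (u := Fintype.card F - 1)
      (f := fun i => (fun _ => 1) - (fun y => ψ i y - 0) ^ (Fintype.card F - 1))
      fun i _ => sub_mem (const_mem_polyFun _ _) (by
        have := pow_mem_polyFun (dual_sub_mem_polyFun (ψ i) 0) (Fintype.card F - 1)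
        rwa [mul_one] at this)
    rwa [Finset.card_univ, Fintype.card_fin] at this
  convert hmem using 1
  funext y
  simp only [Finset.prod_apply, Pi.sub_apply, Pi.pow_apply, sub_zero]
  split_ifs with hy
  · rw [hψ] at hy
    simp [hy, zero_pow (show Fintype.card F - 1 ≠ 0 by omega)]
  · rw [hψ] at hy
    push Not at hy
    obtain ⟨i, hi⟩ := hy
    refine (Finset.prod_eq_zero (Finset.mem_univ i) ?_).symm
    rw [FiniteField.pow_card_sub_one_eq_one _ hi, sub_self]

/-- The extension is the indicator of the flat times `g` composed with a linear retraction onto `W`.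
-/
theorem extendFlat_mem_polyFun [Fintype F] [Module.Finite F V] (W : Submodule F V) {t s : ℕ}
    (ht : Module.finrank F W + t = Module.finrank F V) (x : V) {g : W → F}
    (hg : g ∈ polyFun F W s) :
    extendFlat W x g ∈ polyFun F V (t * (Fintype.card F - 1) + s) := by
  classical
  obtain ⟨π, hπ⟩ := LinearMap.exists_leftInverse_of_injective W.subtype W.ker_subtype
  let τ : V →ᵃ[F] V := AffineMap.id F V - AffineMap.const F V x
  have h1 := comp_affine_mem_polyFun τ (indicator_mem_polyFun W ht)
  have h2 := comp_affine_mem_polyFun (π.toAffineMap.comp τ) hg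
  convert mul_mem_polyFun h1 h2 using 1
  funext y
  have hτ : τ y = y - x := by simp [τ]
  by_cases hy : y - x ∈ W
  · have h3 : π (y - x) = ⟨y - x, hy⟩ := LinearMap.congr_fun hπ ⟨y - x, hy⟩
    simp [extendFlat, hτ, hy, h3, -map_sub]
  · simp [extendFlat, hτ, hy]

variable [Fintype F] [Finite V]

theorem extendFlat_mem_minFun (W : Submodule F V) {t s : ℕ}
    (ht : Module.finrank F W + t = Module.finrank F V) (x : V) {g : W → F}
    (hg : g ∈ minFun F W s) :
    extendFlat W x g ∈ minFun F V (t * (Fintype.card F - 1) + s) := by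
  obtain ⟨hgs, hg0, hw⟩ := hg
  refine ⟨extendFlat_mem_polyFun W ht x hgs, extendFlat_ne_zero hg0, ?_⟩
  rw [weight_extendFlat, hw, minDist_add (by omega), ← ht, Nat.add_sub_cancel]

/-- If the directions differed, the support would lie in a translate of `W ⊓ W'`, which has at most
`q ^ (dim W - 1)` points, against `pow_lt_mul_minDist`. -/
theorem eq_of_extendFlat_eq {W W' : Submodule F V} {s : ℕ} (hs : s < Fintype.card F - 1)
    (hWW' : Module.finrank F W = Module.finrank F W') {x x' : V} {g : W → F} {g' : W' → F}
    (hg : g ∈ minFun F W s) (h : extendFlat W x g = extendFlat W' x' g') :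
    W = W' ∧ x - x' ∈ W' := by
  obtain ⟨-, hg0, hw⟩ := hg
  obtain ⟨y, hy⟩ := Function.ne_iff.1 (extendFlat_ne_zero (x := x) hg0)
  have hyW := sub_mem_of_extendFlat_ne_zero hy
  have hyW' : y - x' ∈ W' := sub_mem_of_extendFlat_ne_zero (by rw [← h]; exact hy)
  have hWeq : W = W' := by
    by_contra hne
    have hlt : W ⊓ W' < W := by
      refine lt_of_le_of_ne inf_le_left fun heq => hne ?_
      exact Submodule.eq_of_le_of_finrank_eq (inf_eq_left.1 heq) hWW'
    have hfin := Submodule.finrank_lt_finrank_of_lt hlt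
    have hle : weight g ≤ Nat.card ↥(W ⊓ W') := by
      rw [← weight_extendFlat W x]
      refine Nat.card_le_card_of_injective
        (fun z : Function.support (extendFlat W x g) => (⟨z.1 - y, ?_, ?_⟩ : ↥(W ⊓ W'))) ?_
      · have := W.sub_mem (sub_mem_of_extendFlat_ne_zero z.2) hyW
        rwa [sub_sub_sub_cancel_right] at this
      · have := W'.sub_mem (sub_mem_of_extendFlat_ne_zero (by rw [← h]; exact z.2)) hyW'
        rwa [sub_sub_sub_cancel_right] at this
      · intro z z' hz
        exact Subtype.ext (sub_left_injective (congrArg Subtype.val hz))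
    rw [hw, Module.natCard_eq_pow_finrank (K := F), Nat.card_eq_fintype_card] at hle
    have h1 := pow_lt_mul_minDist hs (Module.finrank F W)
    have h2 := Nat.mul_le_mul_left (Fintype.card F) hle
    rw [← pow_succ'] at h2
    have h3 := Nat.pow_le_pow_right (Fintype.card_pos (α := F)) (Nat.succ_le_of_lt hfin)
    exact absurd (h1.trans_le (h2.trans h3)) (lt_irrefl _)
  refine ⟨hWeq, ?_⟩
  subst hWeq
  have := W.sub_mem hyW' hyW
  rwa [sub_sub_sub_cancel_left] at this

theorem card_minFun_add {t s K : ℕ} (hs : s < Fintype.card F - 1)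
    (hu : t * (Fintype.card F - 1) + s ≤ Module.finrank F V * (Fintype.card F - 1))
    (hK : ∀ W : Submodule F V, Module.finrank F W + t = Module.finrank F V →
      Nat.card (minFun F W s) = K) :
    Nat.card (minFun F V (t * (Fintype.card F - 1) + s)) =
      qBinomial F (Module.finrank F V) t * (Fintype.card F ^ t * K) := by
  classical
  let T := {W : Submodule F V // Module.finrank F W + t = Module.finrank F V}
  have : Finite (Submodule F V) := Finite.of_injective _ SetLike.coe_injective
  have := Fintype.ofFinite T
  have (W : T) : Finite (V ⧸ W.1) := Finite.of_surjective _ (Submodule.mkQ_surjective W.1)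
  have hcard : Nat.card (Σ W : T, (V ⧸ W.1) × minFun F W.1 s) =
      qBinomial F (Module.finrank F V) t * (Fintype.card F ^ t * K) := by
    rw [Nat.card_sigma, ← card_submodule_add_eq_qBinomial rfl t, Nat.card_eq_fintype_card,
      ← Finset.card_univ, ← smul_eq_mul, ← Finset.sum_const]
    refine Finset.sum_congr rfl fun W _ => ?_
    rw [Nat.card_prod, hK W.1 W.2, Module.natCard_eq_pow_finrank (K := F),
      Nat.card_eq_fintype_card]
    have h1 := W.1.finrank_quotient_add_finrank
    have h2 := W.2
    rw [show Module.finrank F (V ⧸ W.1) = t by omega]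
  rw [← hcard]
  -- A flat is a direction `W` with a class in `V ⧸ W`; `out` fixes the base point so that the
  -- function on `W` is determined.
  refine (Nat.card_congr (Equiv.ofBijective
    (fun p => (⟨extendFlat p.1.1 p.2.1.out p.2.2.1, extendFlat_mem_minFun p.1.1 p.1.2 _ p.2.2.2⟩ :
      minFun F V (t * (Fintype.card F - 1) + s))) ⟨?_, ?_⟩)).symm
  · rintro ⟨⟨W, hW⟩, x, g, hg⟩ ⟨⟨W', hW'⟩, x', g', hg'⟩ h
    have h := congrArg Subtype.val h
    simp only at h
    obtain ⟨rfl, hx⟩ := eq_of_extendFlat_eq hs (Nat.add_right_cancel (hW.trans hW'.symm)) hg h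
    obtain rfl : x = x' := by
      rw [← Submodule.Quotient.eq] at hx
      rwa [Submodule.Quotient.mk_out, Submodule.Quotient.mk_out] at hx
    obtain rfl : g = g' := by
      funext w
      rw [← extendFlat_add W x.out g w, h, extendFlat_add]
    rfl
  · rintro ⟨f, hfu, hf0, hw⟩
    obtain ⟨W, x, hW, hWx, hWf⟩ := exists_flat_of_minDist _ rfl hs hu hfu hf0 hw
    let z : V := (Submodule.Quotient.mk x : V ⧸ W).out
    have hz : z - x ∈ W := by
      rw [← Submodule.Quotient.eq]
      exact Submodule.Quotient.mk_out _
    have hWz : ∀ y, f y ≠ 0 → y - z ∈ W := fun y hy => by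
      have := W.sub_mem (hWx y hy) hz
      rwa [sub_sub_sub_cancel_right] at this
    have hext := extendFlat_eq_self hWz
    refine ⟨⟨⟨W, hW⟩, Submodule.Quotient.mk x, fun w => f (z + w), ?_, ?_, ?_⟩, Subtype.ext hext⟩
    · have := comp_affine_mem_polyFun
        (AffineMap.const F W (⟨z - x, hz⟩ : W) + AffineMap.id F W) hWf
      convert this using 1
      funext w
      simp [← add_assoc]
    · intro h0
      refine hf0 ?_
      rw [← hext, h0]
      funext y
      simp [extendFlat]
    · rw [← weight_extendFlat W z, hext, hw, minDist_add (by omega)]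
      congr 1
      exact Nat.sub_eq_of_eq_add hW.symm

theorem minFun_nonempty {t s : ℕ} (hs : s < Fintype.card F - 1)
    (hu : t * (Fintype.card F - 1) + s ≤ Module.finrank F V * (Fintype.card F - 1)) :
    (minFun F V (t * (Fintype.card F - 1) + s)).Nonempty := by
  have hq : 0 < Fintype.card F - 1 := by omega
  have htm : t ≤ Module.finrank F V :=
    Nat.le_of_mul_le_mul_right ((Nat.le_add_right _ s).trans hu) hq
  obtain ⟨W, hW⟩ : ∃ W : Submodule F V, Module.finrank F W + t = Module.finrank F V := by
    let b := Module.finBasis F V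
    have hli : LinearIndependent F (b ∘ Fin.castLE (Nat.sub_le (Module.finrank F V) t)) :=
      b.linearIndependent.comp _ (Fin.castLE_injective _)
    refine ⟨Submodule.span F (Set.range (b ∘ Fin.castLE (Nat.sub_le _ t))), ?_⟩
    rw [finrank_span_eq_card hli, Fintype.card_fin]
    omega
  suffices h : (minFun F W s).Nonempty by
    obtain ⟨g, hg⟩ := h
    exact ⟨_, extendFlat_mem_minFun W hW 0 hg⟩
  rcases Nat.eq_zero_or_pos s with rfl | hs0
  · exact ⟨_, mem_minFun_zero.2 ⟨1, rfl⟩⟩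
  · have htlt : t < Module.finrank F V := by
      by_contra! h
      have := Nat.mul_le_mul_right (Fintype.card F - 1) h
      omega
    obtain ⟨r, hr⟩ := Nat.exists_eq_add_of_le' (show 1 ≤ Module.finrank F W by omega)
    obtain ⟨l, v, hv⟩ := exists_dual_eq_one F hr
    obtain ⟨B, -, hB⟩ := Finset.exists_subset_card_eq (s := (Finset.univ : Finset F)) (n := s)
      (by rw [Finset.card_univ]; omega)
    subst hB
    exact ⟨_, prod_mem_minFun hr (dual_ne_zero hv) hs one_ne_zero⟩

end Flats

/-! ### Back to Reed–Muller codes -/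

theorem reedMuller_eq_polyFun (F : Type*) [Field F] (u m : ℕ) :
    reedMuller F u m = polyFun F (Fin m → F) u := by
  apply le_antisymm
  · rintro _ ⟨p, hp, rfl⟩
    rw [SetLike.mem_coe, MvPolynomial.mem_restrictTotalDegree] at hp
    rw [p.as_sum, map_sum]
    refine sum_mem fun e he => ?_
    have hdeg : ∑ i, e i ≤ u := by
      refine le_trans ?_ hp
      have := MvPolynomial.le_totalDegree he
      rwa [Finsupp.sum_fintype _ _ fun _ => rfl] at this
    refine polyFun_mono hdeg ?_
    have hprod : ∀ s : Finset (Fin m), (∏ i ∈ s, (fun x : Fin m → F => x i) ^ e i) ∈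
        polyFun F (Fin m → F) (∑ i ∈ s, e i) := by
      intro s
      induction s using Finset.induction_on with
      | empty => exact const_mem_polyFun 1 _
      | insert i s hi ih =>
        rw [Finset.prod_insert hi, Finset.sum_insert hi]
        refine mul_mem_polyFun ?_ ih
        have := pow_mem_polyFun (dual_sub_mem_polyFun (LinearMap.proj i : (Fin m → F) →ₗ[F] F) 0)
          (e i)
        simpa using this
    convert Submodule.smul_mem _ (p.coeff e) (hprod Finset.univ) using 1
    funext x
    simp [MvPolynomial.evalₗ_apply, MvPolynomial.eval_monomial, Finsupp.prod_fintype]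
  · intro f hf
    induction hf using Submodule.pow_induction_on_left' with
    | algebraMap r =>
      refine ⟨MvPolynomial.C r, ?_, ?_⟩
      · rw [SetLike.mem_coe, MvPolynomial.mem_restrictTotalDegree, MvPolynomial.totalDegree_C]
      · funext x
        simp [MvPolynomial.evalₗ_apply]
    | add f g i _ _ hf hg => exact add_mem hf hg
    | mem_mul α hα i f _ hf =>
      obtain ⟨α, rfl⟩ := hα
      obtain ⟨p, hp, rfl⟩ := hf
      rw [SetLike.mem_coe, MvPolynomial.mem_restrictTotalDegree] at hp
      refine ⟨(∑ j, MvPolynomial.C (α.linear (Pi.single j 1)) * MvPolynomial.X j +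
        MvPolynomial.C (α 0)) * p, ?_, ?_⟩
      · rw [SetLike.mem_coe, MvPolynomial.mem_restrictTotalDegree]
        refine (MvPolynomial.totalDegree_mul _ _).trans ?_
        rw [Nat.succ_eq_add_one, add_comm i]
        refine Nat.add_le_add ((MvPolynomial.totalDegree_add _ _).trans (max_le ?_ (by simp))) hp
        refine MvPolynomial.totalDegree_finsetSum_le fun j _ => ?_
        refine (MvPolynomial.totalDegree_mul _ _).trans ?_
        simp
      · funext x
        have hx : α x = ∑ j, α.linear (Pi.single j 1) * x j + α 0 := by
          conv_lhs => rw [AffineMap.decomp α]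
          rw [Pi.add_apply, LinearMap.pi_apply_eq_sum_univ]
          refine congrArg (· + α 0) (Finset.sum_congr rfl fun j _ => ?_)
          rw [smul_eq_mul, mul_comm]
          congr 2
          ext k
          simp [Pi.single_apply, eq_comm]
        simp [MvPolynomial.evalₗ_apply, hx]

theorem hammingNorm_eq_weight {ι F : Type*} [Fintype ι] [Field F] [DecidableEq F] (f : ι → F) :
    hammingNorm f = weight f := by
  exact (Nat.subtype_card _ fun x => by simp).symm

theorem minWeightCodewords_reedMuller {F : Type*} [Field F] [Fintype F] [DecidableEq F]
    {m t s : ℕ} (hs : s < Fintype.card F - 1)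
    (hu : t * (Fintype.card F - 1) + s ≤ m * (Fintype.card F - 1)) :
    minWeightCodewords (reedMuller F (t * (Fintype.card F - 1) + s) m) =
      minFun F (Fin m → F) (t * (Fintype.card F - 1) + s) := by
  -- A function attaining the bound is needed to know that the least weight equals `minDist`.
  obtain ⟨g, hg, hg0, hgw⟩ := minFun_nonempty (F := F) (V := Fin m → F) hs (by simpa using hu)
  ext f
  simp only [minWeightCodewords, minFun, Set.mem_ofPred_eq, reedMuller_eq_polyFun,
    hammingNorm_eq_weight]
  refine and_congr_right fun hf => and_congr_right fun hf0 => ⟨fun h => ?_, fun h f' hf' hf'0 => ?_⟩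
  · exact le_antisymm ((h g hg hg0).trans hgw.le) (minDist_le_weight _ rfl hf hf0)
  · rw [h]
    exact minDist_le_weight _ rfl hf' hf'0

theorem mainTheorem9 {F : Type*} [Field F] [Fintype F] [DecidableEq F]
    (q : ℕ) (hq : Fintype.card F = q) (m : ℕ) (hm : 1 ≤ m) (u : ℕ) (hu : u ≤ m * (q - 1)) :
    (∃! p : ℕ × ℕ, p.1 ≤ m ∧ p.2 < q - 1 ∧ u = p.1 * (q - 1) + p.2) ∧
    ∀ t s : ℕ, t ≤ m → s < q - 1 → u = t * (q - 1) + s →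
      (minWeightCodewords (reedMuller F u m)).ncard =
        if s = 0 then (q - 1) * q ^ t * qBinomial F m t
        else (q - 1) * q ^ t * qBinomial F m t * qBinomial F (m - t) 1 * q.choose s := by
  subst hq
  have hq : 0 < Fintype.card F - 1 := by
    have := Fintype.one_lt_card (α := F)
    omega
  constructor
  · refine ⟨(u / (Fintype.card F - 1), u % (Fintype.card F - 1)),
      ⟨?_, Nat.mod_lt _ hq, (Nat.div_add_mod' _ _).symm⟩, ?_⟩
    · exact Nat.div_le_of_le_mul (by rwa [mul_comm])
    · rintro ⟨t, s⟩ ⟨-, hs, rfl⟩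
      have hs : s < Fintype.card F - 1 := hs
      ext
      · simp [Nat.add_div_of_dvd_right (Dvd.intro_left t rfl), Nat.mul_div_cancel _ hq,
          Nat.div_eq_of_lt hs]
      · simp [Nat.mod_eq_of_lt hs]
  · rintro t s htm hs rfl
    rw [minWeightCodewords_reedMuller hs hu, ← Nat.card_coe_set_eq]
    have hfr : Module.finrank F (Fin m → F) = m := by simp
    split_ifs with hs0
    · subst hs0
      rw [card_minFun_add hs (by rwa [hfr]) fun W _ => card_minFun_zero, hfr]
      ring
    · rw [card_minFun_add (K := (Fintype.card F - 1) * qBinomial F (m - t) 1 *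
        (Fintype.card F).choose s) hs (by rwa [hfr]) ?_, hfr]
      · ring
      · intro W hW
        rw [hfr] at hW
        have htlt : t < m := by
          by_contra! h
          have := Nat.mul_le_mul_right (Fintype.card F - 1) h
          omega
        obtain ⟨r, hr⟩ := Nat.exists_eq_add_of_le' (show 1 ≤ Module.finrank F W by omega)
        rw [card_minFun hr hs (by omega), show m - t = r + 1 by omega]
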